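/- All monoids are commutative. A toric monoid is a finitely generated, torsion-free, integral, saturated and sharp monoid. The torification of a finitely generated monoid $M$ is obtained by taking the image of $M$ in the torsion-free part of its groupification, saturating, and dividing by the units. A tropical type $\tau$ of map to $\mathbb{R}_+=\mathbb{R}_{\geqslant 0}$ consists of: a finite connected graph $\Gamma$ (loops and multiple edges allowed) with vertices $V$, edges $E$ and semi-infinite legs $L$, where each leg carries an index label and each vertex $v$ carries a genus $g_v\in\mathbb{N}$ and a degree $d_v\in\mathbb{Z}$; for every vertex, edge and leg $p$ a face $\sigma_p\in\{0,\mathbb{R}_+\}$ of $\mathbb{R}_+$, with $\sigma_v\subseteq\sigma_e$ whenever $v$ is an end of the edge or leg $e$; and for every oriented edge or leg $\vec e$ a slope $m_{\vec e}\in\mathbb{Z}$, changing sign when the orientation is reversed and equal to $0$ if $\sigma_e=0$; such that for every vertex $v$ the balancing condition $d_v=\sum m_{\vec e}$ holds, the sum being over the edges and legs adjacent to $v$, oriented away from $v$. The tropical monoid $P_\tau$ is the torification of the monoid with generators $\ell_e$ ($e\in E$) and $f(v)$ ($v\in V$ with $\sigma_v=\mathbb{R}_+$) and with a relation $f(v_2)=f(v_1)+m_{\vec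 e}\,\ell_e$ for every oriented edge $\vec e$ from $v_1$ to $v_2$ with $\sigma_e=\mathbb{R}_+$, where $f(v_j)$ is replaced by $0$ if $\sigma_{v_j}=0$, and where the relation is rearranged to have non-negative coefficients if $m_{\vec e}<0$. The type $\tau$ is representable if there are strictly positive edge lengths and a map from the resulting metric graph to $\mathbb{R}_+$ which has slope $m_{\vec e}$ along every oriented edge and leg $\vec e$ and which maps the relative interior of every vertex, edge and leg $p$ into the relative interior of $\sigma_p$. Theorem. Let $k\geqslant 7$ and let $S\subseteq\mathbb{R}^2$ be an arbitrary convex $k$-gon whose vertices are points of $\mathbb{Z}^2$. Let $\sigma^\vee\subseteq\mathbb{R}^3$ be the cone over $S\times\{1\}$ and let $P=\sigma^\vee\cap\mathbb{Z}^3$ be its monoid of lattice points. Then there is no representable tropical type $\tau$ of map to $\mathbb{R}_+$ whose tropical monoid $P_\tau$ is isomorphic to $P$. -/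

import Mathlib

namespace TropicalMaps

noncomputable section

/-! ## Monoid presentations and toric monoids

Monoids are commutative and written additively. -/

/-- A finite monoid presentation `(G | R)`: a finite set `G` of generators and a finite set
`R ⊆ ℕ^G × ℕ^G` of relations. -/
structure MonoidPresentation where
  G : Type*
  finite_G : Finite G
  R : Set ((G →₀ ℕ) × (G →₀ ℕ))
  finite_R : R.Finite

/-- The congruence on `ℕ^G` generated by the relations of a presentation. -/
def MonoidPresentation.con (p : MonoidPresentation) : AddCon (p.G →₀ ℕ) :=
  addConGen fun w₁ w₂ => (w₁, w₂) ∈ p.R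

/-- The monoid `ℕ^G / R` defined by a presentation. -/
abbrev MonoidPresentation.Quotient (p : MonoidPresentation) : Type _ := p.con.Quotient

section Torification

variable (M : Type*) [AddCommMonoid M]

/-- The torsion-free part of the groupification of `M`. -/
abbrev FreeGroupification : Type _ :=
  Algebra.GrothendieckAddGroup M ⧸ AddCommGroup.torsion (Algebra.GrothendieckAddGroup M)

/-- The natural map from `M` to the torsion-free part of its groupification. -/
def toFreeGroupification : M →+ FreeGroupification M :=
  (QuotientAddGroup.mk' (AddCommGroup.torsion (Algebra.GrothendieckAddGroup M))).comp
    (Algebra.GrothendieckAddGroup.of)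

/-- First step of torification: integralise `M` and remove torsion, i.e. take the image of `M` in
the torsion-free part of its groupification. -/
def integralPart : AddSubmonoid (FreeGroupification M) :=
  AddMonoidHom.mrange (toFreeGroupification M)

variable {M} in
/-- The saturation of a submonoid `S` of an abelian group `A`: the elements of `A` having a positive
multiple in `S`. -/
def saturationIn {A : Type*} [AddCommGroup A] (S : AddSubmonoid A) : AddSubmonoid A where
  carrier := {x | ∃ n : ℕ, 0 < n ∧ n • x ∈ S}
  zero_mem' := ⟨1, one_pos, by simp⟩
  add_mem' := by
    rintro x y ⟨a, ha, hx⟩ ⟨b, hb, hy⟩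
    refine ⟨a * b, Nat.mul_pos ha hb, ?_⟩
    rw [nsmul_add]
    refine S.add_mem ?_ ?_
    · rw [mul_comm, mul_nsmul']
      exact S.nsmul_mem hx b
    · rw [mul_nsmul']
      exact S.nsmul_mem hy a

/-- Second step of torification: saturate. Note that the image of `M` generates
`FreeGroupification M` as a group. -/
def saturatedPart : AddSubmonoid (FreeGroupification M) :=
  saturationIn (integralPart M)

/-- The torification of `M`. The third and last step is to sharpen, i.e. to divide the saturated
monoid `S` by its group of units `S ∩ -S`; the quotient is the image of `S` in the quotient of the
ambient group by `S ∩ -S`. -/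
def torification : AddSubmonoid (FreeGroupification M ⧸ (saturatedPart M).support) :=
  (saturatedPart M).map (QuotientAddGroup.mk' (saturatedPart M).support)

end Torification

/-! ## Tropical types of maps to the orthant `ℝ^n_{≥ 0}` -/

/-- The relative interior of the face `σ_I` of the orthant `ℝ^n_{≥ 0}` that is spanned by the
standard basis vectors `e_i`, `i ∈ I`. -/
def relIntFace {n : ℕ} (I : Finset (Fin n)) : Set (Fin n → ℝ) :=
  {x | (∀ i ∈ I, 0 < x i) ∧ ∀ i ∉ I, x i = 0}

open Classical in
/-- A tropical type of map to the orthant `ℝ^n_{≥ 0}`. The faces of the orthant are the cones `σ_I`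
spanned by the `e_i` with `i ∈ I`, and a face is recorded by its index set `I ⊆ {1, …, n}`; thus
`σ_I` is a face of `σ_J` if and only if `I ⊆ J`, and an integral vector lies in the span of `σ_I` if
and only if its coordinates outside `I` vanish.

The graph may have loops and multiple edges. Every edge `e` comes with an auxiliary reference
orientation, from `src e` to `tgt e`; its slope in this orientation is `slope e`, and its slope in
the opposite orientation is `-slope e`. Legs are oriented away from the vertex they are attached
to. -/
structure TropicalType (n : ℕ) where
  /-- vertices -/
  V : Type*
  /-- finite edges -/
  E : Type*
  /-- semi-infinite legs -/
  L : Type*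
  [fintypeV : Fintype V]
  [fintypeE : Fintype E]
  [fintypeL : Fintype L]
  /-- source of an edge -/
  src : E → V
  /-- target of an edge -/
  tgt : E → V
  /-- the vertex that a leg is attached to -/
  base : L → V
  /-- the graph is connected, and in particular non-empty -/
  nonempty : Nonempty V
  connected : ∀ v w : V, Relation.EqvGen (fun a b => ∃ e, src e = a ∧ tgt e = b) v w
  /-- number of index labels of legs -/
  numLabels : ℕ
  /-- index label of a leg -/
  label : L → Fin numLabels
  /-- genus label of a vertex -/
  genus : V → ℕ
  /-- multi-degree label of a vertex -/
  degree : V → Fin n → ℤ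
  /-- the face `σ_v` -/
  faceV : V → Finset (Fin n)
  /-- the face `σ_e` -/
  faceE : E → Finset (Fin n)
  /-- the face `σ_l` -/
  faceL : L → Finset (Fin n)
  faceV_src_subset : ∀ e, faceV (src e) ⊆ faceE e
  faceV_tgt_subset : ∀ e, faceV (tgt e) ⊆ faceE e
  faceV_base_subset : ∀ l, faceV (base l) ⊆ faceL l
  /-- slope of an edge, in its reference orientation -/
  slope : E → Fin n → ℤ
  /-- outgoing slope of a leg -/
  legSlope : L → Fin n → ℤ
  slope_mem_span : ∀ e, ∀ i ∉ faceE e, slope e i = 0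
  legSlope_mem_span : ∀ l, ∀ i ∉ faceL l, legSlope l i = 0
  /-- the multi-degree of `v` is the sum of the slopes of the adjacent edges and legs, oriented away
  from `v` (a loop is adjacent twice, once in each orientation) -/
  balancing : ∀ v, degree v =
    (∑ e : {e : E // src e = v}, slope e) + (∑ e : {e : E // tgt e = v}, -slope e)
      + ∑ l : {l : L // base l = v}, legSlope l

attribute [instance] TropicalType.fintypeV TropicalType.fintypeE TropicalType.fintypeL

namespace TropicalType

variable {n : ℕ} (τ : TropicalType n)

/-- The generators of the tropical presentation: `ℓ_e` for every edge `e`, and `f(v)_i` for every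
vertex `v` and every `i ∈ I(v)`. -/
abbrev Gen : Type _ := τ.E ⊕ {p : τ.V × Fin n // p.2 ∈ τ.faceV p.1}

/-- The generator `ℓ_e`. -/
def edgeLength (e : τ.E) : τ.Gen →₀ ℕ := Finsupp.single (Sum.inl e) 1

/-- The generator `f(v)_i` if `i ∈ I(v)`, and `0` otherwise. -/
def position (v : τ.V) (i : Fin n) : τ.Gen →₀ ℕ :=
  if h : i ∈ τ.faceV v then Finsupp.single (Sum.inr ⟨(v, i), h⟩) 1 else 0

/-- The relation `f(v₂)_i = f(v₁)_i + (m_e)_i ℓ_e` for an edge `e` from `v₁` to `v₂`, rearranged so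
that all coefficients are non-negative. (The opposite orientation of `e` gives the same relation.) -/
def relation (e : τ.E) (i : Fin n) : (τ.Gen →₀ ℕ) × (τ.Gen →₀ ℕ) :=
  (τ.position (τ.tgt e) i + (-τ.slope e i).toNat • τ.edgeLength e,
    τ.position (τ.src e) i + (τ.slope e i).toNat • τ.edgeLength e)

/-- The tropical presentation of a tropical type: there is one relation for every edge `e` and every
`i ∈ I(e)`. -/
def presentation : MonoidPresentation where
  G := τ.Gen
  finite_G := inferInstance
  R := {r | ∃ e, ∃ i ∈ τ.faceE e, r = τ.relation e i}
  finite_R := by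
    refine (Set.finite_range fun p : τ.E × Fin n => τ.relation p.1 p.2).subset ?_
    rintro r ⟨e, i, -, rfl⟩
    exact ⟨(e, i), rfl⟩

/-- The tropical monoid `P_τ`: the toric monoid associated to the tropical presentation. -/
abbrev TropicalMonoid : Type _ := torification τ.presentation.Quotient

/-- A tropical type is representable if there are strictly positive edge lengths and a map `f` from
the resulting metric graph to the orthant, with the prescribed slopes along all edges and legs,
that maps the relative interior of every vertex, edge and leg into the relative interior of the
associated face. Such a map is determined by its values `f v` at the vertices: the point at
distance `t` from `src e` on `e` is mapped to `f (src e) + t m_e`, and similarly for legs. -/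
def Representable : Prop :=
  ∃ (len : τ.E → ℝ) (f : τ.V → Fin n → ℝ),
    (∀ e, 0 < len e) ∧
    (∀ e, f (τ.tgt e) = f (τ.src e) + len e • fun i => (τ.slope e i : ℝ)) ∧
    (∀ v, f v ∈ relIntFace (τ.faceV v)) ∧
    (∀ e, ∀ t ∈ Set.Ioo 0 (len e),
      (f (τ.src e) + t • fun i => (τ.slope e i : ℝ)) ∈ relIntFace (τ.faceE e)) ∧
    (∀ l, ∀ t : ℝ, 0 < t →
      (f (τ.base l) + t • fun i => (τ.legSlope l i : ℝ)) ∈ relIntFace (τ.faceL l))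

end TropicalType

/-! ## Cones over lattice polygons -/

/-- The inclusion of the lattice `ℤ^2` into `ℝ^2`. -/
def latticePoint (p : Fin 2 → ℤ) : Fin 2 → ℝ := fun i => (p i : ℝ)

/-- `S` is a convex `k`-gon with vertices in `ℤ^2`: the convex hull of `k` lattice points, none of
which lies in the convex hull of the others. (A convex polygon for `k ≥ 3`.) -/
def IsLatticePolygon (k : ℕ) (S : Set (Fin 2 → ℝ)) : Prop :=
  ∃ p : Fin k → Fin 2 → ℤ,
    ConvexIndependent ℝ (fun j => latticePoint (p j)) ∧
      S = convexHull ℝ (Set.range fun j => latticePoint (p j))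

/-- The cone over `S × {1}` in `ℝ^3 = ℝ^2 × ℝ`. -/
def coneOver (S : Set (Fin 2 → ℝ)) : PointedCone ℝ ((Fin 2 → ℝ) × ℝ) :=
  PointedCone.hull ℝ (S ×ˢ {1})

/-- The inclusion of the lattice `ℤ^3 = ℤ^2 × ℤ` into `ℝ^3 = ℝ^2 × ℝ`. -/
def latticeInclusion : (Fin 2 → ℤ) × ℤ →+ (Fin 2 → ℝ) × ℝ where
  toFun x := (latticePoint x.1, (x.2 : ℝ))
  map_zero' := by ext <;> simp [latticePoint]
  map_add' x y := by ext <;> simp [latticePoint]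

/-- The monoid of lattice points of the cone over `S × {1}`. -/
def latticeMonoid (S : Set (Fin 2 → ℝ)) : AddSubmonoid ((Fin 2 → ℤ) × ℤ) :=
  (coneOver S).toAddSubmonoid.comap latticeInclusion

end

end TropicalMaps

namespace TropicalMaps

noncomputable section

/-! ### Torification and real-valued functionals -/

section Torification

variable {M : Type*} [AddCommMonoid M]

/-! The group of `P` has rank 3, and its cone has `k` extremal rays. In the group of `P_τ`, the
lengths of slope-zero edges and the distinct non-zero vertex positions can be given arbitrary real
values, because every other edge length is then forced. They are therefore linearly independent, so
there are at most 3 of them (`exists_hom_basisElement`, `linearIndependent_of_exists_hom`).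

An extremal ray must be spanned by the image of a generator (`exists_eq_smul_vertex`). Up to a
non-zero multiple this image is a basis element or a difference of two (`exists_zsmul_gen_eq`). So a
ray determines an unordered pair of basis elements, possibly equal, and the pair determines the ray.
There are at most 6 such pairs, hence `k ≤ 6`.

Representability enters only through sharpness: dividing by units changes nothing, so functionals on
the presented monoid descend to `P_τ`. -/

theorem exists_hom_freeGroupification (h : M →+ ℝ) :
    ∃ H : FreeGroupification M →+ ℝ, ∀ m, H (toFreeGroupification M m) = h m := by
  refine ⟨QuotientAddGroup.lift _ (Algebra.GrothendieckAddGroup.lift h) ?_, fun m => ?_⟩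
  · intro x hx
    obtain ⟨n, hn, hx⟩ := isOfFinAddOrder_iff_nsmul_eq_zero.1 hx
    have h0 := congrArg (Algebra.GrothendieckAddGroup.lift h) hx
    rw [map_nsmul, map_zero, smul_eq_zero] at h0
    exact h0.resolve_left hn.ne'
  · exact DFunLike.congr_fun (Algebra.GrothendieckAddGroup.lift.symm_apply_apply h) m

theorem eq_zero_of_nsmul_freeGroupification {x : FreeGroupification M} {n : ℕ} (hn : 0 < n)
    (h : n • x = 0) : x = 0 := by
  induction x using QuotientAddGroup.induction_on with
  | H y =>
    rw [← QuotientAddGroup.mk_nsmul, QuotientAddGroup.eq_zero_iff] at h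
    rw [QuotientAddGroup.eq_zero_iff]
    obtain ⟨k, hk, h⟩ := isOfFinAddOrder_iff_nsmul_eq_zero.1 h
    exact isOfFinAddOrder_iff_nsmul_eq_zero.2 ⟨k * n, Nat.mul_pos hk hn, by rw [mul_nsmul', h]⟩

/-- A strictly positive real functional forces the saturation to be sharp. -/
theorem eq_zero_of_mem_support (h : M →+ ℝ) (h0 : ∀ m, 0 ≤ h m) (h1 : ∀ m, h m = 0 → m = 0)
    {x : FreeGroupification M} (hx : x ∈ (saturatedPart M).support) : x = 0 := by
  obtain ⟨H, hH⟩ := exists_hom_freeGroupification h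
  obtain ⟨⟨n, hn, m, hm⟩, n', hn', m', hm'⟩ := (AddSubmonoid.mem_support).1 hx
  have e := congrArg H hm
  have e' := congrArg H hm'
  rw [hH, map_nsmul, nsmul_eq_mul] at e e'
  rw [map_neg] at e'
  have hn0 : (0 : ℝ) < n := by exact_mod_cast hn
  have hn0' : (0 : ℝ) < n' := by exact_mod_cast hn'
  have a := h0 m
  have a' := h0 m'
  rw [e] at a
  rw [e'] at a'
  -- Positive multiples of both `x` and `-x` come from `M`, where the functional is non-negative.
  have hHx : H x = 0 := le_antisymm (by nlinarith [nonneg_of_mul_nonneg_right a' hn0'])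
    (nonneg_of_mul_nonneg_right a hn0)
  have := h1 m (by rw [e, hHx, mul_zero])
  rw [this, map_zero] at hm
  exact eq_zero_of_nsmul_freeGroupification hn hm.symm

/-- The natural map from a monoid to its torification. -/
def toTorification (M : Type*) [AddCommMonoid M] : M →+ torification M :=
  ((QuotientAddGroup.mk' (saturatedPart M).support).comp (toFreeGroupification M)).codRestrict
    (torification M) fun m =>
      AddSubmonoid.mem_map_of_mem _ ⟨1, one_pos, by rw [one_nsmul]; exact ⟨m, rfl⟩⟩

theorem exists_nsmul_eq_toTorification (t : torification M) :
    ∃ n : ℕ, 0 < n ∧ ∃ m, n • t = toTorification M m := by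
  obtain ⟨_, x, ⟨n, hn, m, hm⟩, rfl⟩ := t
  refine ⟨n, hn, m, Subtype.ext ?_⟩
  exact (congrArg (QuotientAddGroup.mk' (saturatedPart M).support) hm).symm

theorem exists_hom_torification (hM : ∀ x ∈ (saturatedPart M).support, x = 0) (h : M →+ ℝ) :
    ∃ H : torification M →+ ℝ, ∀ m, H (toTorification M m) = h m := by
  obtain ⟨H, hH⟩ := exists_hom_freeGroupification h
  refine ⟨(QuotientAddGroup.lift (saturatedPart M).support H ?_).comp (torification M).subtype,
    fun m => hH m⟩
  intro x hx
  rw [hM x hx]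
  exact H.map_zero

/-- Elements of `M` whose values under real functionals can be prescribed arbitrarily stay linearly
independent under every embedding of the torification into a group. -/
theorem linearIndependent_of_exists_hom {A I : Type*} [AddCommGroup A] [Finite I]
    (hM : ∀ x ∈ (saturatedPart M).support, x = 0) (ψ : torification M →+ A)
    (hψ : Function.Injective ψ) (z : I → M) (hz : ∀ u : I → ℝ, ∃ h : M →+ ℝ, ∀ i, h (z i) = u i) :
    LinearIndependent ℤ fun i => ψ (toTorification M (z i)) := by
  classical
  cases nonempty_fintype I
  rw [Fintype.linearIndependent_iff]
  intro c hc j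
  obtain ⟨h, hh⟩ := hz (Pi.single j 1)
  obtain ⟨H, hH⟩ := exists_hom_torification hM h
  -- `ψ` is injective only on the monoid, so the relation is split by sign to put both sides there.
  -- The functional dual to `z j` then reads off `c j`.
  have key : ψ (∑ i, (c i).toNat • toTorification M (z i)) =
      ψ (∑ i, (-c i).toNat • toTorification M (z i)) := by
    rw [← sub_eq_zero, map_sum, map_sum, ← Finset.sum_sub_distrib, ← hc]
    refine Finset.sum_congr rfl fun i _ => ?_
    rw [map_nsmul, map_nsmul, ← natCast_zsmul, ← natCast_zsmul, ← sub_smul,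
      Int.toNat_sub_toNat_neg]
  have key' := congrArg H (hψ key)
  simp only [map_sum, map_nsmul, hH, hh, nsmul_eq_mul, Pi.single_apply, mul_ite, mul_one, mul_zero,
    Finset.sum_ite_eq', Finset.mem_univ, if_true, Nat.cast_inj] at key'
  omega

end Torification

/-! ### The tropical presentation and its functionals -/

namespace TropicalType

variable (τ : TropicalType 1)

/-- The quotient map from the free monoid on the generators to the presented monoid. -/
def presMap : (τ.Gen →₀ ℕ) →+ τ.presentation.Quotient := τ.presentation.con.mk'

theorem presMap_surjective : Function.Surjective τ.presMap := AddCon.mk'_surjective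

/-- A generator of the presentation, as an element of the presented monoid. -/
def gen (g : τ.Gen) : τ.presentation.Quotient :=
  τ.presMap (Finsupp.single g 1)

/-- The position `f(v)` of a vertex, as an element of the presented monoid. -/
def pos (v : τ.V) : τ.presentation.Quotient :=
  τ.presMap (τ.position v 0)

theorem gen_inr (p : {p : τ.V × Fin 1 // p.2 ∈ τ.faceV p.1}) :
    τ.gen (Sum.inr p) = τ.pos p.1.1 := by
  obtain ⟨⟨v, i⟩, hi⟩ := p
  obtain rfl : i = 0 := Subsingleton.elim _ _
  refine congrArg τ.presMap ?_
  rw [position, dif_pos hi]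

theorem presMap_eq_sum (c : τ.Gen →₀ ℕ) :
    τ.presMap c = c.sum fun g n => n • τ.gen g := by
  conv_lhs => rw [← Finsupp.sum_single c]
  rw [Finsupp.sum, map_sum, Finsupp.sum]
  refine Finset.sum_congr rfl fun g _ => ?_
  rw [gen, ← map_nsmul, Finsupp.smul_single_one]

theorem pos_tgt_add (e : τ.E) (he : 0 ∈ τ.faceE e) :
    τ.pos (τ.tgt e) + (-τ.slope e 0).toNat • τ.gen (Sum.inl e) =
      τ.pos (τ.src e) + (τ.slope e 0).toNat • τ.gen (Sum.inl e) := by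
  simp only [pos, gen, ← map_nsmul, ← map_add]
  exact (AddCon.eq _).2 (AddConGen.Rel.of _ _ ⟨e, 0, he, rfl⟩)

theorem pos_eq_zero {v : τ.V} (hv : 0 ∉ τ.faceV v) : τ.pos v = 0 := by
  rw [pos, position, dif_neg hv, map_zero]

theorem pos_tgt_eq_of_slope_eq_zero (e : τ.E) (he : τ.slope e 0 = 0) :
    τ.pos (τ.tgt e) = τ.pos (τ.src e) := by
  by_cases h : 0 ∈ τ.faceE e
  · simpa [he] using τ.pos_tgt_add e h
  · rw [τ.pos_eq_zero fun h' => h (τ.faceV_tgt_subset e h'),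
      τ.pos_eq_zero fun h' => h (τ.faceV_src_subset e h')]

/-- Edge lengths and vertex positions that are compatible with the slopes define a functional. -/
theorem exists_hom (len : τ.E → ℝ) (f : τ.V → ℝ) (hf : ∀ v, 0 ∉ τ.faceV v → f v = 0)
    (h : ∀ e, f (τ.tgt e) = f (τ.src e) + len e * τ.slope e 0) :
    ∃ H : τ.presentation.Quotient →+ ℝ, (∀ e, H (τ.gen (Sum.inl e)) = len e) ∧
      ∀ v, H (τ.pos v) = f v := by
  let w : (τ.Gen →₀ ℕ) →+ ℝ :=
    Finsupp.liftAddHom fun g => AddMonoidHom.flip (smulAddHom ℕ ℝ)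
      (Sum.elim len (fun p => f p.1.1) g)
  have hw : ∀ (g : τ.Gen) (n : ℕ), w (Finsupp.single g n) =
      n * Sum.elim len (fun p => f p.1.1) g := by
    intro g n
    simp [w]
  have hpos : ∀ v, w (τ.position v 0) = f v := by
    intro v
    by_cases hv : 0 ∈ τ.faceV v
    · rw [position, dif_pos hv, hw]
      simp
    · rw [position, dif_neg hv, map_zero, hf v hv]
  refine ⟨τ.presentation.con.lift w ?_, fun e => ?_, hpos⟩
  · refine AddCon.addConGen_le.2 ?_
    rintro _ _ ⟨e, i, -, hr⟩
    obtain rfl : i = 0 := Subsingleton.elim _ _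
    obtain ⟨rfl, rfl⟩ := Prod.mk.inj hr
    change w _ = w _
    rw [map_add, map_add, map_nsmul, map_nsmul, hpos, hpos, h, edgeLength, hw]
    have : (((τ.slope e 0).toNat : ℤ) : ℝ) - (((-τ.slope e 0).toNat : ℤ) : ℝ) = τ.slope e 0 := by
      rw [← Int.cast_sub, Int.toNat_sub_toNat_neg]
    simp only [Int.cast_natCast] at this
    simp only [nsmul_eq_mul, Nat.cast_one, one_mul, Sum.elim_inl, ← this]
    ring
  · change w (Finsupp.single (Sum.inl e) 1) = _
    rw [hw]
    simp

/-- The edge lengths and vertex positions of a realisation form a functional that is strictly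
positive on every generator. -/
theorem Representable.eq_zero_of_mem_support {τ : TropicalType 1} (hτ : τ.Representable) :
    ∀ x ∈ (saturatedPart τ.presentation.Quotient).support, x = 0 := by
  obtain ⟨len, f, hlen, hf, hface, -, -⟩ := hτ
  obtain ⟨H, h1, h2⟩ := τ.exists_hom len (fun v => f v 0) (fun v hv => (hface v).2 0 hv)
    (fun e => by simpa using congrFun (hf e) 0)
  have hpos : ∀ g, 0 < H (τ.gen g) := by
    rintro (e | p)
    · rw [h1]
      exact hlen e
    · rw [gen_inr, h2]
      have hp := p.2
      rw [Subsingleton.elim p.1.2 0] at hp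
      exact (hface _).1 0 hp
  have hmk : ∀ c : τ.Gen →₀ ℕ, H (τ.presMap c) = ∑ g ∈ c.support,
      (c g : ℝ) * H (τ.gen g) := by
    intro c
    rw [presMap_eq_sum, Finsupp.sum, map_sum]
    exact Finset.sum_congr rfl fun g _ => by rw [map_nsmul, nsmul_eq_mul]
  have hnn : ∀ (c : τ.Gen →₀ ℕ), ∀ g ∈ c.support, 0 ≤ (c g : ℝ) * H (τ.gen g) :=
    fun c g _ => mul_nonneg (Nat.cast_nonneg _) (hpos g).le
  refine fun x hx => TropicalMaps.eq_zero_of_mem_support H (fun m => ?_) (fun m hm => ?_) hx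
  · obtain ⟨c, rfl⟩ := τ.presMap_surjective m
    rw [hmk]
    exact Finset.sum_nonneg (hnn c)
  · obtain ⟨c, rfl⟩ := τ.presMap_surjective m
    rw [hmk, Finset.sum_eq_zero_iff_of_nonneg (hnn c)] at hm
    have : c = 0 := by
      ext g
      by_contra hg
      have h3 := hm g (Finsupp.mem_support_iff.2 hg)
      rcases mul_eq_zero.1 h3 with h4 | h4
      · exact hg (by exact_mod_cast h4)
      · exact (hpos g).ne' h4
    rw [this, map_zero]

/-! ### A basis, and the generators in terms of it -/

/-- Index set of a basis of the groupification of the tropical monoid: the edges of slope zero and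
the distinct non-zero vertex positions. -/
abbrev BasisIndex : Type _ :=
  {e : τ.E // τ.slope e 0 = 0} ⊕ {m : τ.presentation.Quotient // m ≠ 0 ∧ m ∈ Set.range τ.pos}

instance : Finite τ.BasisIndex := by
  have : Finite {m : τ.presentation.Quotient // m ≠ 0 ∧ m ∈ Set.range τ.pos} :=
    ((Set.finite_range τ.pos).subset fun m hm => hm.2 :
      {m | m ≠ 0 ∧ m ∈ Set.range τ.pos}.Finite).to_subtype
  infer_instance

/-- The basis elements, in the presented monoid. -/
def basisElement : τ.BasisIndex → τ.presentation.Quotient :=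
  Sum.elim (fun e => τ.gen (Sum.inl e)) Subtype.val

theorem exists_hom_basisElement (u : τ.BasisIndex → ℝ) :
    ∃ H : τ.presentation.Quotient →+ ℝ, ∀ i, H (τ.basisElement i) = u i := by
  classical
  -- Defined through the class of the position, so vertices with equal positions get equal values,
  -- as slope-zero edges require.
  let s : τ.V → ℝ := fun v =>
    if h : τ.pos v ≠ 0 then u (Sum.inr ⟨τ.pos v, h, v, rfl⟩) else 0
  have hs : ∀ v v', τ.pos v = τ.pos v' → s v = s v' := by
    intro v v' h
    simp only [s, h]
  obtain ⟨H, h1, h2⟩ := τ.exists_hom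
    -- A non-zero slope forces the edge length; its sign is irrelevant, since `exists_hom` accepts
    -- any real lengths.
    (fun e => if h : τ.slope e 0 = 0 then u (Sum.inl ⟨e, h⟩) else
      (s (τ.tgt e) - s (τ.src e)) / τ.slope e 0) s
    (fun v hv => dif_neg (not_not.2 (τ.pos_eq_zero hv))) (fun e => by
      by_cases h : τ.slope e 0 = 0
      · simp [h, hs _ _ (τ.pos_tgt_eq_of_slope_eq_zero e h)]
      · have : (τ.slope e 0 : ℝ) ≠ 0 := by exact_mod_cast h
        rw [dif_neg h]
        field_simp
        ring)
  refine ⟨H, ?_⟩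
  rintro (⟨e, he⟩ | ⟨_, hm, v, rfl⟩)
  · simp [basisElement, h1, he]
  · simp only [basisElement, Sum.elim_inr, h2]
    exact dif_pos hm

open Classical in
/-- A generator that does not vanish in a group `A` is there, up to an integral multiple, a basis
element or a difference of two basis elements. -/
theorem exists_zsmul_gen_eq {A : Type*} [AddCommGroup A] [IsAddTorsionFree A]
    (ψ : τ.presentation.Quotient →+ A) (g : τ.Gen) (hg : ψ (τ.gen g) ≠ 0) :
    ∃ (a b : τ.BasisIndex) (d : ℤ), d ≠ 0 ∧ d • ψ (τ.gen g) =
      if a = b then ψ (τ.basisElement a) else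
        ψ (τ.basisElement a) - ψ (τ.basisElement b) := by
  rcases g with e | p
  · by_cases he : τ.slope e 0 = 0
    · exact ⟨Sum.inl ⟨e, he⟩, Sum.inl ⟨e, he⟩, 1, one_ne_zero, by simp [basisElement]⟩
    have hface : 0 ∈ τ.faceE e := by
      by_contra h
      exact he (τ.slope_mem_span e 0 h)
    have h := congrArg ψ (τ.pos_tgt_add e hface)
    rw [map_add, map_add, map_nsmul, map_nsmul, ← natCast_zsmul, ← natCast_zsmul] at h
    have h' : τ.slope e 0 • ψ (τ.gen (Sum.inl e)) = ψ (τ.pos (τ.tgt e)) - ψ (τ.pos (τ.src e)) := by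
      conv_lhs => rw [← Int.toNat_sub_toNat_neg (τ.slope e 0), sub_smul]
      rw [sub_eq_sub_iff_add_eq_add, h, add_comm]
    have hne : τ.slope e 0 • ψ (τ.gen (Sum.inl e)) ≠ 0 := by
      rw [Ne, smul_eq_zero]
      exact not_or.2 ⟨he, hg⟩
    by_cases ht : τ.pos (τ.tgt e) = 0
    · by_cases hsrc : τ.pos (τ.src e) = 0
      · rw [ht, hsrc, sub_self] at h'
        exact absurd h' hne
      · refine ⟨Sum.inr ⟨_, hsrc, _, rfl⟩, Sum.inr ⟨_, hsrc, _, rfl⟩, -τ.slope e 0,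
          neg_ne_zero.2 he, ?_⟩
        rw [if_pos rfl, neg_zsmul, h', ht]
        simp [basisElement]
    · by_cases hsrc : τ.pos (τ.src e) = 0
      · refine ⟨Sum.inr ⟨_, ht, _, rfl⟩, Sum.inr ⟨_, ht, _, rfl⟩, τ.slope e 0, he, ?_⟩
        rw [if_pos rfl, h', hsrc]
        simp [basisElement]
      · refine ⟨Sum.inr ⟨_, ht, _, rfl⟩, Sum.inr ⟨_, hsrc, _, rfl⟩, τ.slope e 0, he, ?_⟩
        rw [if_neg, h']
        · rfl
        · intro hab
          have : τ.pos (τ.tgt e) = τ.pos (τ.src e) := congrArg Subtype.val (Sum.inr.inj hab)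
          rw [this, sub_self] at h'
          exact hne h'
  · rw [gen_inr] at hg ⊢
    have hp : τ.pos p.1.1 ≠ 0 := fun h => hg (by rw [h, map_zero])
    exact ⟨Sum.inr ⟨_, hp, _, rfl⟩, Sum.inr ⟨_, hp, _, rfl⟩, 1, one_ne_zero, by simp [basisElement]⟩

end TropicalType

/-! ### Extremal rays of the cone over a polygon -/

theorem coneOver_convexHull_le_span {ι : Type*} (q : ι → Fin 2 → ℝ) :
    coneOver (convexHull ℝ (Set.range q)) ≤
      PointedCone.hull ℝ (Set.range fun i => ((q i, 1) : (Fin 2 → ℝ) × ℝ)) := by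
  set C := PointedCone.hull ℝ (Set.range fun i => ((q i, 1) : (Fin 2 → ℝ) × ℝ))
  refine Submodule.span_le.2 ?_
  rintro ⟨z, t⟩ ⟨hz, rfl : t = 1⟩
  have hconv : Convex ℝ {z : Fin 2 → ℝ | ((z, 1) : (Fin 2 → ℝ) × ℝ) ∈ C} := by
    intro x hx y hy a b ha hb hab
    have := C.add_mem (C.smul_mem ha hx) (C.smul_mem hb hy)
    rwa [Prod.smul_mk, Prod.smul_mk, Prod.mk_add_mk, smul_eq_mul, smul_eq_mul, mul_one, mul_one,
      hab] at this
  refine convexHull_min ?_ hconv hz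
  rintro _ ⟨i, rfl⟩
  exact Submodule.subset_span ⟨i, rfl⟩

/-- The vertices of a polygon are extremal in the cone over it. -/
theorem exists_eq_smul_vertex {ι G : Type*} [Fintype ι] {q : ι → Fin 2 → ℝ}
    (hq : ConvexIndependent ℝ q) (j : ι) (s : Finset G) (y : G → (Fin 2 → ℝ) × ℝ)
    (hy : ∀ g ∈ s, y g ∈ coneOver (convexHull ℝ (Set.range q))) {n : ℝ} (hn : 0 < n)
    (h : ∑ g ∈ s, y g = n • (q j, (1 : ℝ))) :
    ∃ g ∈ s, ∃ r : ℝ, r ≠ 0 ∧ y g = r • (q j, (1 : ℝ)) := by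
  classical
  have hex : ∀ g ∈ s, ∃ a : ι → NNReal, ∑ i, a i • ((q i, 1) : (Fin 2 → ℝ) × ℝ) = y g :=
    fun g hg => (Submodule.mem_span_range_iff_exists_fun _).1
      (coneOver_convexHull_le_span q (hy g hg))
  choose! a ha using hex
  set b : ι → ℝ := fun i => ∑ g ∈ s, (a g i : ℝ) with hb
  have hb0 : ∀ i, 0 ≤ b i := fun i => Finset.sum_nonneg fun g _ => NNReal.coe_nonneg _
  have hsum : ∑ i, b i • ((q i, 1) : (Fin 2 → ℝ) × ℝ) = n • (q j, (1 : ℝ)) := by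
    rw [← h, Finset.sum_congr rfl fun g hg => (ha g hg).symm, Finset.sum_comm]
    refine Finset.sum_congr rfl fun i _ => ?_
    rw [hb, Finset.sum_smul]
    rfl
  have hfst : ∑ i, b i • q i = n • q j := by
    simpa [Prod.fst_sum] using congrArg Prod.fst hsum
  have hsnd : ∑ i, b i = n := by
    simpa [Prod.snd_sum] using congrArg Prod.snd hsum
  have hrest : ∑ i ∈ Finset.univ.erase j, b i = 0 := by
    by_contra hne
    have hpos : 0 < ∑ i ∈ Finset.univ.erase j, b i :=
      lt_of_le_of_ne (Finset.sum_nonneg fun i _ => hb0 i) (Ne.symm hne)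
    -- Any weight off `j` would make `q j` a convex combination of the other vertices.
    have hmem : (Finset.univ.erase j).centerMass b q ∈ convexHull ℝ (q '' {j}ᶜ) :=
      Finset.centerMass_mem_convexHull _ (fun i _ => hb0 i) hpos fun i hi =>
        ⟨i, Finset.ne_of_mem_erase hi, rfl⟩
    have hc : (Finset.univ.erase j).centerMass b q = q j := by
      rw [Finset.centerMass, inv_smul_eq_iff₀ hne]
      rw [← Finset.add_sum_erase _ _ (Finset.mem_univ j)] at hfst hsnd
      rw [← hsnd, add_smul] at hfst
      exact add_left_cancel hfst
    rw [hc] at hmem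
    exact hq {j}ᶜ j hmem rfl
  have hzero : ∀ i, i ≠ j → ∀ g ∈ s, a g i = 0 := by
    intro i hi g hg
    have h1 := (Finset.sum_eq_zero_iff_of_nonneg fun i _ => hb0 i).1 hrest i
      (Finset.mem_erase.2 ⟨hi, Finset.mem_univ i⟩)
    exact NNReal.coe_eq_zero.1
      ((Finset.sum_eq_zero_iff_of_nonneg fun g _ => NNReal.coe_nonneg _).1 h1 g hg)
  have hbj : b j = n := by
    rw [← Finset.add_sum_erase _ _ (Finset.mem_univ j), hrest, add_zero] at hsnd
    exact hsnd
  obtain ⟨g, hg, hgj⟩ := Finset.exists_ne_zero_of_sum_ne_zero (hbj.trans_ne hn.ne')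
  refine ⟨g, hg, a g j, hgj, ?_⟩
  rw [← ha g hg, Finset.sum_eq_single j]
  · rfl
  · intro i _ hi
    rw [hzero i hi g hg, zero_smul]
  · simp

end

end TropicalMaps

/-! ### Counting rays -/

/-- For `k ≥ 7`, the monoid of lattice points of the cone over a convex lattice `k`-gon is not
isomorphic to the tropical monoid of any representable tropical type of map to `ℝ_{≥ 0}`. -/
theorem theoremD (k : ℕ) (hk : 7 ≤ k) (S : Set (Fin 2 → ℝ))
    (hS : TropicalMaps.IsLatticePolygon k S) :
    ¬ ∃ τ : TropicalMaps.TropicalType 1, τ.Representable ∧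
      Nonempty (τ.TropicalMonoid ≃+ TropicalMaps.latticeMonoid S) := by
  classical
  rintro ⟨τ, hτ, ⟨φ⟩⟩
  obtain ⟨p, hp, rfl⟩ := hS
  set S := convexHull ℝ (Set.range fun j => TropicalMaps.latticePoint (p j))
  let ψ : τ.TropicalMonoid →+ (Fin 2 → ℤ) × ℤ :=
    (TropicalMaps.latticeMonoid S).subtype.comp φ.toAddMonoidHom
  have hψ : Function.Injective ψ := Subtype.val_injective.comp φ.injective
  let χ := ψ.comp (TropicalMaps.toTorification τ.presentation.Quotient)
  cases nonempty_fintype τ.BasisIndex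
  have hcard : Fintype.card τ.BasisIndex ≤ 3 := by
    have := (TropicalMaps.linearIndependent_of_exists_hom hτ.eq_zero_of_mem_support ψ hψ
      τ.basisElement τ.exists_hom_basisElement).fintype_card_le_finrank
    simpa using this
  have hvertex : ∀ j, ∃ g : τ.Gen, ∃ r : ℝ, r ≠ 0 ∧
      TropicalMaps.latticeInclusion (χ (τ.gen g)) =
        r • (TropicalMaps.latticePoint (p j), (1 : ℝ)) := by
    intro j
    have hincl : TropicalMaps.latticeInclusion (p j, 1) =
        (TropicalMaps.latticePoint (p j), (1 : ℝ)) := by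
      simp [TropicalMaps.latticeInclusion]
    have hmem : (p j, (1 : ℤ)) ∈ TropicalMaps.latticeMonoid S := by
      refine Submodule.subset_span ⟨subset_convexHull ℝ _ ⟨j, rfl⟩, ?_⟩
      simp [TropicalMaps.latticeInclusion]
    -- Saturation only adds roots, so a multiple of the vertex is a sum of generators.
    obtain ⟨n, hn, m, hm⟩ := TropicalMaps.exists_nsmul_eq_toTorification (φ.symm ⟨_, hmem⟩)
    obtain ⟨c, rfl⟩ := τ.presMap_surjective m
    have h := congrArg (fun t => TropicalMaps.latticeInclusion (ψ t)) hm
    have hψj : ψ (φ.symm ⟨_, hmem⟩) = (p j, 1) := by simp [ψ]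
    simp only [map_nsmul, hψj, TropicalMaps.TropicalType.presMap_eq_sum, Finsupp.sum, map_sum] at h
    obtain ⟨g, hg, r, hr, hgr⟩ := TropicalMaps.exists_eq_smul_vertex hp j c.support
      (fun g => c g • TropicalMaps.latticeInclusion (χ (τ.gen g)))
      (fun g _ => AddSubmonoid.nsmul_mem (TropicalMaps.coneOver S).toAddSubmonoid
        (φ (TropicalMaps.toTorification _ (τ.gen g))).2 _)
      (n := n) (by exact_mod_cast hn) (by
        rw [Nat.cast_smul_eq_nsmul]
        rw [← hincl]
        exact h.symm)
    have hcg : (c g : ℝ) ≠ 0 := Nat.cast_ne_zero.2 (Finsupp.mem_support_iff.1 hg)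
    refine ⟨g, (c g : ℝ)⁻¹ * r, mul_ne_zero (inv_ne_zero hcg) hr, ?_⟩
    rw [mul_smul, ← hgr, ← Nat.cast_smul_eq_nsmul ℝ, inv_smul_smul₀ hcg]
  choose g r hr hgr using hvertex
  have hne : ∀ j, χ (τ.gen (g j)) ≠ 0 := by
    intro j h0
    have h1 := congrArg Prod.snd (hgr j)
    rw [h0, map_zero] at h1
    exact hr j (by simpa using h1.symm)
  choose a b d hd hab using fun j => τ.exists_zsmul_gen_eq χ (g j) (hne j)
  have hinj : Function.Injective fun j => s(a j, b j) := by
    intro i j hij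
    -- Swapping the pair flips the sign of a difference, which is harmless up to multiples.
    have hpm : ∃ d' : ℤ, d' ≠ 0 ∧ d i • χ (τ.gen (g i)) = d' • χ (τ.gen (g j)) := by
      rcases Sym2.eq_iff.1 hij with ⟨h1, h2⟩ | ⟨h1, h2⟩
      · exact ⟨d j, hd j, by rw [hab, hab, h1, h2]⟩
      · by_cases hj : a j = b j
        · exact ⟨d j, hd j, by rw [hab, hab, h1, h2, hj]⟩
        · refine ⟨-d j, neg_ne_zero.2 (hd j), ?_⟩
          rw [neg_zsmul, hab, hab, h1, h2, if_neg hj, if_neg (Ne.symm hj), neg_sub]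
    obtain ⟨d', hd', h⟩ := hpm
    have h := congrArg TropicalMaps.latticeInclusion h
    rw [map_zsmul, map_zsmul, hgr, hgr, ← Int.cast_smul_eq_zsmul ℝ, ← Int.cast_smul_eq_zsmul ℝ,
      smul_smul, smul_smul] at h
    -- Vertices sit at height 1, so the last coordinate compares the scalars.
    have h2 : (d i : ℝ) * r i = d' * r j := by simpa using congrArg Prod.snd h
    have h1 := congrArg Prod.fst h
    rw [← h2] at h1
    exact hp.injective (smul_right_injective _
      (mul_ne_zero (Int.cast_ne_zero.2 (hd i)) (hr i)) h1)
  have hk' := Fintype.card_le_of_injective _ hinj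
  rw [Fintype.card_fin, Sym2.card] at hk'
  have : (Fintype.card τ.BasisIndex + 1).choose 2 ≤ Nat.choose 4 2 :=
    Nat.choose_le_choose 2 (by omega)
  have h6 : Nat.choose 4 2 = 6 := rfl
  omega
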